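/- Let $M$ be a smooth (Hausdorff, second countable) oriented $3$-manifold without boundary and let $(\varphi,\omega,T,g)$ be a smooth almost contact metric structure on $M$: $\varphi$ is a smooth field of endomorphisms of $TM$, $\omega$ a smooth $1$-form, $T$ a smooth vector field and $g=\langle\cdot,\cdot\rangle$ a smooth Riemannian metric with $$\varphi^2X=-X+\omega(X)\,T,\qquad \omega(T)=1,\qquad \langle\varphi X,\varphi Y\rangle=\langle X,Y\rangle-\omega(X)\,\omega(Y).$$ Put $\eta=\iota_T\,d\omega=d\omega(T,\cdot)$ and $\eta^*=\eta\circ\varphi$, with the convention $d\alpha(X,Y)=X\alpha(Y)-Y\alpha(X)-\alpha([X,Y])$ for $1$-forms $\alpha$, and $$gv^*=\int_M\eta^*\wedge d\eta^*.$$ Let $\nabla$ be the Levi-Civita connection of $g$ and $k=|\nabla_TT|$ the curvature of the $T$-curves. On the open set $U=\{k\neq0\}$ let $N=k^{-1}\nabla_TT$ be the unit normal, $B=T\times N$ the binormal (so that $(T,N,B)$ is a positively oriented orthonormal frame) and $\tau=-\langle\nabla_TB,N\rangle$ the torsion of the $T$-curves, and let $h_{X,Y}=\langle\nabla_XY,T\rangle$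 $(X,Y\in\ker\omega)$ be the non-symmetric second fundamental form of $\ker\omega$. The function $k^2(\tau+h_{N,B})$ is understood to be $0$ on $M\setminus U$. Then the $3$-form $\eta^*\wedge d\eta^*$ is absolutely integrable over $M$ if and only if the function $k^2(\tau+h_{N,B})$ is integrable with respect to the Riemannian volume $d\mathrm{vol}_g$, and in that case $$gv^*=-\int_M k^2\,(\tau+h_{N,B})\,d\mathrm{vol}_g .$$ -/

import Mathlib

open scoped Manifold ContDiff Topology
open Bundle MeasureTheory Set

noncomputable section

namespace GodbillonVey

/-- The model space `ℝ³`. -/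
abbrev E3 : Type := EuclideanSpace ℝ (Fin 3)

section Forms

/-! ### Vector fields and differential forms on a 3-manifold -/

variable (M : Type*) [TopologicalSpace M] [ChartedSpace E3 M]

/-- A (not necessarily smooth) vector field on `M`. -/
abbrev VField : Type _ := ∀ x : M, TangentSpace (𝓡 3) x

/-- A (not necessarily smooth) 1-form on `M`. -/
abbrev OneForm : Type _ := ∀ x : M, TangentSpace (𝓡 3) x →L[ℝ] ℝ

/-- A (not necessarily smooth) 2-form on `M`. -/
abbrev TwoForm : Type _ := ∀ x : M, TangentSpace (𝓡 3) x [⋀^Fin 2]→L[ℝ] ℝ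

/-- A (not necessarily smooth) 3-form on `M`. -/
abbrev ThreeForm : Type _ := ∀ x : M, TangentSpace (𝓡 3) x [⋀^Fin 3]→ₗ[ℝ] ℝ

/-- A (not necessarily smooth) field of endomorphisms of the tangent spaces of `M`. -/
abbrev EndoField : Type _ := ∀ x : M, TangentSpace (𝓡 3) x →L[ℝ] TangentSpace (𝓡 3) x

variable {M}

/-- A 1-form read in the chart at `p`: its pull-back under the inverse of the chart. -/
def inChart (α : OneForm M) (p : M) (y : E3) : E3 [⋀^Fin 1]→L[ℝ] ℝ :=
  ContinuousAlternatingMap.ofSubsingleton ℝ E3 ℝ (0 : Fin 1)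
    (((α ((extChartAt (𝓡 3) p).symm y)).comp
      (mfderiv 𝓘(ℝ, E3) (𝓡 3) (extChartAt (𝓡 3) p).symm y)).comp
      ((NormedSpace.fromTangentSpace (𝕜 := ℝ) y).symm : E3 →L[ℝ] TangentSpace 𝓘(ℝ, E3) y))

/-- The exterior derivative `dα` of a 1-form: at `x`, it is computed in the chart at `x`. With the
normalization of `extDeriv`, `dα(X, Y) = X α(Y) - Y α(X) - α([X, Y])`. -/
def dOne (α : OneForm M) : TwoForm M := fun x =>
  (extDeriv (inChart α x) (extChartAt (𝓡 3) x x)).compContinuousLinearMap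
    ((NormedSpace.fromTangentSpace (𝕜 := ℝ) (extChartAt (𝓡 3) x x) :
        TangentSpace 𝓘(ℝ, E3) (extChartAt (𝓡 3) x x) →L[ℝ] E3).comp
      (mfderiv (𝓡 3) 𝓘(ℝ, E3) (extChartAt (𝓡 3) x) x))

/-- The interior product `ι_X β = β(X, ·)`, see `interiorProduct_apply`. -/
def interiorProduct (X : VField M) (β : TwoForm M) : OneForm M := fun x =>
  (β x).toContinuousMultilinearMap.toContinuousLinearMap ![X x, 0] 1

theorem interiorProduct_apply (X : VField M) (β : TwoForm M) (x : M) (u : TangentSpace (𝓡 3) x) :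
    interiorProduct X β x u = β x ![X x, u] := by
  have h : Function.update ![X x, 0] 1 u = ![X x, u] := by
    ext i; fin_cases i <;> simp
  change β x (Function.update ![X x, 0] 1 u) = _
  rw [h]

theorem twoForm_swap (β : TwoForm M) (x : M) (a b : TangentSpace (𝓡 3) x) :
    β x ![a, b] = - β x ![b, a] := by
  have := (β x).toAlternatingMap.map_swap ![b, a] (i := 0) (j := 1) (by decide)
  have h : (![b, a] ∘ Equiv.swap (0 : Fin 2) 1) = ![a, b] := by
    ext i; fin_cases i <;> simp
  rw [h] at this
  exact this

/-- The wedge product of a 1-form and a 2-form,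
`(α ∧ β)(u, v, w) = α(u) β(v, w) - α(v) β(u, w) + α(w) β(u, v)`. -/
def wedge (α : OneForm M) (β : TwoForm M) : ThreeForm M := fun x =>
  { toFun := fun v => α x (v 0) * β x ![v 1, v 2] - α x (v 1) * β x ![v 0, v 2]
      + α x (v 2) * β x ![v 0, v 1]
    map_update_add' := by
      intro inst v i u w
      obtain rfl : inst = instDecidableEqFin 3 := Subsingleton.elim _ _
      have h0 : ∀ a b c : TangentSpace (𝓡 3) x, β x ![a + b, c] = β x ![a, c] + β x ![b, c] :=
        fun a b c => (β x).toMultilinearMap.cons_add ![c] a b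
      have h1 : ∀ a b c : TangentSpace (𝓡 3) x, β x ![c, a + b] = β x ![c, a] + β x ![c, b] :=
        fun a b c => by rw [twoForm_swap, h0, twoForm_swap β x a c, twoForm_swap β x b c]; ring
      fin_cases i <;> simp [h0, h1] <;> ring
    map_update_smul' := by
      intro inst v i r u
      obtain rfl : inst = instDecidableEqFin 3 := Subsingleton.elim _ _
      have h0 : ∀ (r : ℝ) (a c : TangentSpace (𝓡 3) x), β x ![r • a, c] = r * β x ![a, c] :=
        fun r a c => (β x).toMultilinearMap.cons_smul ![c] r a
      have h1 : ∀ (r : ℝ) (a c : TangentSpace (𝓡 3) x), β x ![c, r • a] = r * β x ![c, a] :=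
        fun r a c => by rw [twoForm_swap, h0, twoForm_swap β x a c]; ring
      fin_cases i <;> simp [h0, h1] <;> ring
    map_eq_zero_of_eq' := by
      intro v i j hij hne
      have h0 : ∀ a : TangentSpace (𝓡 3) x, β x ![a, a] = 0 := fun a =>
        (β x).map_eq_zero_of_eq ![a, a] (i := 0) (j := 1) rfl (by decide)
      fin_cases i <;> fin_cases j <;> simp at hij hne ⊢ <;> simp [hij, h0] <;>
        first | (rw [twoForm_swap β x (v 1) (v 2)]; ring) | (rw [twoForm_swap β x (v 0) (v 1)]; ring) }

/-- The 1-form `α ∘ φ`. -/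
def compEndo (α : OneForm M) (φ : EndoField M) : OneForm M := fun x => (α x).comp (φ x)

end Forms

section AlmostContact

variable (M : Type*) [TopologicalSpace M] [ChartedSpace E3 M] [IsManifold (𝓡 3) ∞ M]

/-- An almost contact structure `(φ, ω, T) = (phi, omega, T)` on a 3-manifold, all tensors being smooth. -/
structure AlmostContactStructure where
  /-- the endomorphism field -/
  phi : EndoField M
  /-- the 1-form -/
  omega : OneForm M
  /-- the Reeb vector field -/
  T : VField M
  smooth_phi : ContMDiff (𝓡 3) ((𝓡 3).prod 𝓘(ℝ, E3 →L[ℝ] E3)) ∞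
    (fun x => TotalSpace.mk' (E3 →L[ℝ] E3)
      (E := fun x : M => TangentSpace (𝓡 3) x →L[ℝ] TangentSpace (𝓡 3) x) x (phi x))
  smooth_omega : ContMDiff (𝓡 3) ((𝓡 3).prod 𝓘(ℝ, E3 →L[ℝ] ℝ)) ∞
    (fun x => TotalSpace.mk' (E3 →L[ℝ] ℝ)
      (E := fun x : M => TangentSpace (𝓡 3) x →L[ℝ] Bundle.Trivial M ℝ x) x (omega x))
  smooth_T : ContMDiff (𝓡 3) (𝓡 3).tangent ∞ (fun x => (⟨x, T x⟩ : TangentBundle (𝓡 3) M))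
  phi_phi : ∀ (x : M) (X : TangentSpace (𝓡 3) x), phi x (phi x X) = -X + omega x X • T x
  omega_T : ∀ x : M, omega x (T x) = 1

variable {M}

/-- The 1-form `η = ι_T dω`. -/
def AlmostContactStructure.eta (S : AlmostContactStructure M) : OneForm M :=
  interiorProduct S.T (dOne S.omega)

/-- The 1-form `η* = η ∘ φ`. -/
def AlmostContactStructure.etaStar (S : AlmostContactStructure M) : OneForm M :=
  compEndo S.eta S.phi

/-- The 3-form `η* ∧ dη*`. -/
def AlmostContactStructure.gvForm (S : AlmostContactStructure M) : ThreeForm M :=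
  wedge S.etaStar (dOne S.etaStar)

end AlmostContact

section Integration

/-! ### Orientation and integration of 3-forms -/

variable {M : Type*} [TopologicalSpace M] [ChartedSpace E3 M]

/-- The coordinate vector fields `∂₀, ∂₁, ∂₂` of the chart at `p`
(meaningful at the points of the domain of that chart). -/
def coordFrame (p : M) (x : M) (i : Fin 3) : TangentSpace (𝓡 3) x :=
  VectorField.mpullback (𝓡 3) 𝓘(ℝ, E3) (extChartAt (𝓡 3) p)
    (fun y => (NormedSpace.fromTangentSpace (𝕜 := ℝ) y).symm (EuclideanSpace.single i (1 : ℝ))) x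

/-- The sign of a triple of tangent vectors with respect to an orientation of the tangent space:
`1` for a positively oriented basis, `-1` for a negatively oriented one, `0` if the vectors are
linearly dependent. (`someVector` is any alternating form that represents the orientation.) -/
def orientationSign {x : M} (o : Orientation ℝ (TangentSpace (𝓡 3) x) (Fin 3))
    (v : Fin 3 → TangentSpace (𝓡 3) x) : ℝ :=
  SignType.sign (o.someVector v)

variable (M) in
/-- An orientation of the 3-manifold `M`: orientations of the tangent spaces such that the sign of
each coordinate frame is locally constant on the domain of the chart. -/
structure ManifoldOrientation where
  /-- the orientation of the tangent space at a point -/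
  at' : ∀ x : M, Orientation ℝ (TangentSpace (𝓡 3) x) (Fin 3)
  locallyConstant : ∀ p : M, ∀ x ∈ (extChartAt (𝓡 3) p).source, ∀ᶠ y in 𝓝 x,
    orientationSign (at' y) (coordFrame p y) = orientationSign (at' x) (coordFrame p x)

variable (M) in
/-- There is a choice of a chart around each point, `x` lying in the domain of the chart at `c x`,
such that only countably many charts are used, each of them on a measurable set. -/
theorem exists_chartSelector [SecondCountableTopology M] [MeasurableSpace M] [BorelSpace M] :
    ∃ c : M → M, (range c).Countable ∧ (∀ p, MeasurableSet (c ⁻¹' {p})) ∧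
      ∀ x, x ∈ (extChartAt (𝓡 3) (c x)).source := by
  classical
  obtain ⟨s, hs, hU⟩ := TopologicalSpace.countable_cover_nhds
    (f := fun p : M => (extChartAt (𝓡 3) p).source) (fun p => extChartAt_source_mem_nhds p)
  rcases isEmpty_or_nonempty M with hM | hM
  · exact ⟨id, by simp [Set.eq_empty_of_isEmpty], fun p => hM.elim p, fun x => hM.elim x⟩
  have hne : s.Nonempty := by
    rw [nonempty_iff_ne_empty]
    rintro rfl
    rw [biUnion_empty] at hU
    exact empty_ne_univ hU
  obtain ⟨f, rfl⟩ := hs.exists_eq_range hne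
  have hex : ∀ x : M, ∃ n, x ∈ (extChartAt (𝓡 3) (f n)).source := fun x => by
    have : x ∈ ⋃ p ∈ range f, (extChartAt (𝓡 3) p).source := hU ▸ mem_univ x
    simpa using this
  refine ⟨fun x => f (Nat.find (hex x)), ?_, ?_, fun x => Nat.find_spec (hex x)⟩
  · exact (countable_range f).mono (by rintro _ ⟨x, rfl⟩; exact mem_range_self _)
  · intro p
    have hm : Measurable fun x => Nat.find (hex x) :=
      measurable_find hex fun n => (isOpen_extChartAt_source (f n)).measurableSet
    exact hm (MeasurableSet.of_discrete (s := f ⁻¹' {p}))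

variable [SecondCountableTopology M] [MeasurableSpace M] [BorelSpace M]

/-- A fixed decomposition of `M` into countably many disjoint measurable pieces, each in the domain
of one chart: `x` lies in the domain of the chart at `chartSelector x`. -/
def chartSelector : M → M := (exists_chartSelector M).choose

/-- Lebesgue measure transported to `M` by the chart at `p`. -/
def chartMeasure (p : M) : Measure M :=
  (volume.restrict (extChartAt (𝓡 3) p).target).map (extChartAt (𝓡 3) p).symm

variable (M) in
/-- The measure on `M` which on each piece `chartSelector ⁻¹' {p}` of the decomposition is
Lebesgue measure in the chart at `p`. -/
def coordMeasure : Measure M :=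
  Measure.sum fun p : range (chartSelector (M := M)) =>
    (chartMeasure (p : M)).restrict (chartSelector ⁻¹' {(p : M)})

/-- The density of a 3-form on an oriented manifold with respect to `coordMeasure`: at a point of
the piece belonging to the chart at `p`, it is `± α(∂₀, ∂₁, ∂₂)` for the coordinate fields of that
chart, with the sign `+` if and only if they are positively oriented. -/
def formDensity (o : ManifoldOrientation M) (α : ThreeForm M) (x : M) : ℝ :=
  orientationSign (o.at' x) (coordFrame (chartSelector x) x) * α x (coordFrame (chartSelector x) x)

/-- Absolute integrability of a 3-form over an oriented 3-manifold. -/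
def FormIntegrable (o : ManifoldOrientation M) (α : ThreeForm M) : Prop :=
  Integrable (formDensity o α) (coordMeasure M)

/-- The integral `∫_M α` of a 3-form over an oriented 3-manifold: the sum, over the pieces of the
decomposition, of the integrals of `± α(∂₀, ∂₁, ∂₂) dy₀ dy₁ dy₂` in the respective chart. By the
change of variables formula neither this value nor integrability depends on the decomposition. -/
def formIntegral (o : ManifoldOrientation M) (α : ThreeForm M) : ℝ :=
  ∫ x, formDensity o α x ∂(coordMeasure M)

variable [IsManifold (𝓡 3) ∞ M] in
/-- The functional `gv* = ∫_M η* ∧ dη*`. -/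
def gvStar (o : ManifoldOrientation M) (S : AlmostContactStructure M) : ℝ :=
  formIntegral o S.gvForm

end Integration

section Riemannian

/-! ### Riemannian geometry of a 3-manifold -/

variable {M : Type*} [TopologicalSpace M] [ChartedSpace E3 M] [IsManifold (𝓡 3) ∞ M]
  [RiemannianBundle (fun x : M => TangentSpace (𝓡 3) x)]

instance (x : M) : FiniteDimensional ℝ (TangentSpace (𝓡 3) x) :=
  inferInstanceAs (FiniteDimensional ℝ E3)

instance (x : M) : Fact (Module.finrank ℝ (TangentSpace (𝓡 3) x) = 3) :=
  ⟨by
    change Module.finrank ℝ E3 = 3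
    simp⟩

/-- The derivative `X f` of a function along a vector field. -/
def deriveAlong (X : VField M) (f : M → ℝ) (x : M) : ℝ :=
  NormedSpace.fromTangentSpace (𝕜 := ℝ) (f x) (mfderiv (𝓡 3) 𝓘(ℝ, ℝ) f x (X x))

/-- The function `⟨X, Y⟩`. -/
def metric (X Y : VField M) (x : M) : ℝ := inner ℝ (X x) (Y x)

/-- The value of `⟨∇_X Y, Z⟩` given by the Koszul formula. -/
def koszul (X Y Z : VField M) (x : M) : ℝ :=
  (deriveAlong X (metric Y Z) x + deriveAlong Y (metric X Z) x - deriveAlong Z (metric X Y) x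
    + metric (VectorField.mlieBracket (𝓡 3) X Y) Z x
    - metric (VectorField.mlieBracket (𝓡 3) X Z) Y x
    - metric (VectorField.mlieBracket (𝓡 3) Y Z) X x) / 2

/-- The Levi-Civita connection: `∇_X Y` at `x` is the vector whose components in an orthonormal
basis of the tangent space at `x` are given by the Koszul formula, applied to vector fields that
extend the basis vectors. -/
def nabla (X Y : VField M) : VField M := fun x =>
  ∑ i, koszul X Y (FiberBundle.extend E3 (stdOrthonormalBasis ℝ (TangentSpace (𝓡 3) x) i)) x •
    stdOrthonormalBasis ℝ (TangentSpace (𝓡 3) x) i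

/-- The cross product of two vector fields on an oriented Riemannian 3-manifold:
`⟨X × Y, Z⟩ = dvol(X, Y, Z)`. -/
def cross (o : ManifoldOrientation M) (X Y : VField M) : VField M := fun x =>
  ∑ i, (o.at' x).volumeForm ![X x, Y x, stdOrthonormalBasis ℝ (TangentSpace (𝓡 3) x) i] •
    stdOrthonormalBasis ℝ (TangentSpace (𝓡 3) x) i

/-- The curvature `k = |∇_T T|` of the integral curves of a unit vector field `T`. -/
def curv (T : VField M) (x : M) : ℝ := ‖nabla T T x‖

/-- The unit normal `N = ∇_T T / k` of the `T`-curves (and `N = 0` where `k = 0`). -/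
def normal (T : VField M) : VField M := fun x => (curv T x)⁻¹ • nabla T T x

/-- The binormal `B = T × N` of the `T`-curves. -/
def binormal (o : ManifoldOrientation M) (T : VField M) : VField M := cross o T (normal T)

/-- The torsion `τ = -⟨∇_T B, N⟩` of the `T`-curves. -/
def tors (o : ManifoldOrientation M) (T : VField M) (x : M) : ℝ :=
  -metric (nabla T (binormal o T)) (normal T) x

/-- The non-symmetric second fundamental form `h_{X,Y} = ⟨∇_X Y, T⟩` of the plane field orthogonal
to `T`, for vector fields `X`, `Y` orthogonal to `T`. -/
def secondFF (T X Y : VField M) (x : M) : ℝ := metric (nabla X Y) T x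

/-- The Riemannian metric is compatible with the almost contact structure:
`⟨φX, φY⟩ = ⟨X, Y⟩ - ω(X) ω(Y)`. -/
def AlmostContactStructure.IsCompatible (S : AlmostContactStructure M) : Prop :=
  ∀ (x : M) (X Y : TangentSpace (𝓡 3) x),
    inner ℝ (S.phi x X) (S.phi x Y) = inner ℝ X Y - S.omega x X * S.omega x Y

variable (M) in
/-- The Riemannian volume measure `dvol_g`: Lebesgue measure in each chart, multiplied by
`√(det g_{ij})`, where `g_{ij} = ⟨∂_i, ∂_j⟩`. -/
def riemannianVolume [SecondCountableTopology M] [MeasurableSpace M] [BorelSpace M] : Measure M :=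
  (coordMeasure M).withDensity fun x => ENNReal.ofReal (Real.sqrt (Matrix.det
    (Matrix.of fun i j : Fin 3 => (inner ℝ (coordFrame (chartSelector x) x i)
      (coordFrame (chartSelector x) x j) : ℝ))))

end Riemannian

end GodbillonVey

end

open GodbillonVey

/-!
The two integrals agree because the integrands do: at every point
`η* ∧ dη* = -k² (τ + h_{N,B}) dvol_g`.

The compatibility relations give `φT = 0`, `ω = ⟨T, ·⟩`, `|T| = 1`, and that `φ` is skew and rotates
the plane `ker ω` by a right angle. Together with the Koszul formula they show that `η = ι_T dω` is
the metric dual of the acceleration `∇_T T` (`AlmostContactStructure.eta_apply`). Hence `η*` vanishes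
where `k = 0`, and both sides of the identity are zero there. Where `k ≠ 0`, the binormal is
`B = ε φN` with a locally constant sign `ε`, so `η* = -ε k ⟨B, ·⟩` annihilates `T` and `N`, and the
invariant formula for the exterior derivative (`dOne_apply`) yields

`(η* ∧ dη*)(T, N, B) = η*(B) dη*(T, N) = -η*(B) η*([T, N]) = -k² ⟨B, [T, N]⟩`.

On the other hand `τ + h_{N,B} = ⟨∇_N B, T⟩ - ⟨∇_T B, N⟩ = ⟨∇_T N - ∇_N T, B⟩ = ⟨[T, N], B⟩`
(`AlmostContactStructure.IsCompatible.tors_add_secondFF`). This proves the identity on the Frenet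
frame, and so on all triples of vectors.

These computations require the fields `∇_T T`, `N` and `B` to be differentiable, although they are
defined pointwise. For `∇_T T` this comes from a frame `(T, E, φE)` with `E` horizontal, in which its
components are `η(E) = -ω([T, E])` and `η(φE) = -ω([T, φE])`, up to the factor `|E|⁻²`
(`AlmostContactStructure.diffAt_nabla`). For `B` it comes from the local constancy of `ε`, a
consequence of that of the orientation (`eventually_sign_volumeForm_eq`).

Finally, the Gram determinant of a frame is the square of its volume, so the density of `η* ∧ dη*` in
coordinates is `√det(g_{ij})` times the right-hand integrand, and `√det(g_{ij})` is the density of the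
Riemannian volume.
-/

open scoped Manifold ContDiff Topology
open Bundle MeasureTheory Set

noncomputable section

namespace GodbillonVey

/-! ### The exterior derivative of a 1-form on vector fields -/

section ChartCalculus

variable {M : Type*} [TopologicalSpace M] [ChartedSpace E3 M]

/-- A vector field read in the chart at `p`: its pull-back under the inverse of the chart. Only the
values on the target of the chart are meaningful. -/
def vecInChart (X : VField M) (p : M) (y : E3) : E3 :=
  VectorField.mpullbackWithin 𝓘(ℝ, E3) (𝓡 3) (extChartAt (𝓡 3) p).symm X (range (𝓡 3)) y

variable [IsManifold (𝓡 3) ∞ M]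

/-- Differentiability of a vector field at a point. -/
abbrev VField.DiffAt (X : VField M) (x : M) : Prop :=
  MDifferentiableAt (𝓡 3) (𝓡 3).tangent (fun y => (⟨y, X y⟩ : TangentBundle (𝓡 3) M)) x

/-- At its base point the preferred chart has the identity as differential, so that a vector field
and its chart expression have the same value there. -/
theorem vecInChart_self (X : VField M) (x : M) :
    vecInChart X x (extChartAt (𝓡 3) x x) = X x := by
  have h1 : vecInChart X x (extChartAt (𝓡 3) x x) =
      X ((extChartAt (𝓡 3) x).symm (extChartAt (𝓡 3) x x)) :=
    mfderivWithin_extChartAt_symm_inverse_apply (𝕜 := ℝ) (I := 𝓡 3) (x := x)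
      (X ((extChartAt (𝓡 3) x).symm (extChartAt (𝓡 3) x x)) : E3)
  exact h1.trans (congrArg (fun p => (X p : E3)) (extChartAt_to_inv x))

theorem inChart_apply_vecInChart (α : OneForm M) (X : VField M) (p : M) {y : E3}
    (hy : y ∈ (extChartAt (𝓡 3) p).target) (v : Fin 1 → E3) (hv : v 0 = vecInChart X p y) :
    inChart α p y v = α ((extChartAt (𝓡 3) p).symm y) (X ((extChartAt (𝓡 3) p).symm y)) := by
  have h := isInvertible_mfderivWithin_extChartAt_symm (I := 𝓡 3) hy
  have h2 := h.self_apply_inverse (X ((extChartAt (𝓡 3) p).symm y))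
  rw [ModelWithCorners.range_eq_univ, mfderivWithin_univ] at h2
  unfold inChart
  have h3 : (mfderiv 𝓘(ℝ, E3) (𝓡 3) (extChartAt (𝓡 3) p).symm y) (v 0)
    = X ((extChartAt (𝓡 3) p).symm y) := by
    rw [hv, vecInChart, VectorField.mpullbackWithin_apply, ModelWithCorners.range_eq_univ,
      mfderivWithin_univ]
    exact h2
  change α _ ((mfderiv 𝓘(ℝ, E3) (𝓡 3) (extChartAt (𝓡 3) p).symm y) (v 0)) = _
  rw [h3]

theorem mlieBracket_eq_lieBracket (X Y : VField M) (x : M) :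
    VectorField.mlieBracket (𝓡 3) X Y x =
      VectorField.lieBracket ℝ (vecInChart X x) (vecInChart Y x) (extChartAt (𝓡 3) x x) := by
  rw [← VectorField.mlieBracketWithin_univ, VectorField.mlieBracketWithin_apply]
  rw [mfderiv_extChartAt_self]
  have h : (ContinuousLinearMap.id ℝ E3).inverse = ContinuousLinearMap.id ℝ E3 :=
    ContinuousLinearMap.inverse_id
  have h2 : VectorField.lieBracketWithin ℝ (vecInChart X x) (vecInChart Y x)
      ((extChartAt (𝓡 3) x).symm ⁻¹' univ ∩ range (𝓡 3)) (extChartAt (𝓡 3) x x) =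
      VectorField.lieBracket ℝ (vecInChart X x) (vecInChart Y x) (extChartAt (𝓡 3) x x) := by
    rw [preimage_univ, univ_inter, ModelWithCorners.range_eq_univ,
      VectorField.lieBracketWithin_univ]
  exact (congrArg (fun L : E3 →L[ℝ] E3 => L _) h).trans h2

theorem deriveAlong_eq_fderiv (X : VField M) {f : M → ℝ} {x : M}
    (hf : MDifferentiableAt (𝓡 3) 𝓘(ℝ, ℝ) f x) :
    deriveAlong X f x = fderiv ℝ (f ∘ (extChartAt (𝓡 3) x).symm) (extChartAt (𝓡 3) x x)
      (vecInChart X x (extChartAt (𝓡 3) x x)) := by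
  rw [vecInChart_self]
  have h : mfderiv (𝓡 3) 𝓘(ℝ, ℝ) f x = fderivWithin ℝ (writtenInExtChartAt (𝓡 3) 𝓘(ℝ, ℝ) x f)
      (range (𝓡 3)) (extChartAt (𝓡 3) x x) := if_pos hf
  rw [ModelWithCorners.range_eq_univ, fderivWithin_univ] at h
  exact congrArg (fun L : E3 →L[ℝ] ℝ => L (X x)) h

theorem VField.DiffAt.vecInChart {X : VField M} {x : M} (hX : X.DiffAt x) :
    DifferentiableAt ℝ (vecInChart X x) (extChartAt (𝓡 3) x x) := by
  have : IsManifold (𝓡 3) 2 M := IsManifold.of_le (n := ∞) (by norm_cast)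
  have h : DifferentiableWithinAt ℝ (GodbillonVey.vecInChart X x)
      ((extChartAt (𝓡 3) x).symm ⁻¹' univ ∩ range (𝓡 3)) (extChartAt (𝓡 3) x x) :=
    MDifferentiableWithinAt.differentiableWithinAt_mpullbackWithin_vectorField (𝕜 := ℝ)
    (I := 𝓡 3) (M := M) (s := univ) (V := X) (x := x) hX.mdifferentiableWithinAt
  rwa [preimage_univ, univ_inter, ModelWithCorners.range_eq_univ, differentiableWithinAt_univ] at h

/-- At the base point of the chart no change of frame occurs in the definition of `dOne`. -/
theorem dOne_apply_self (α : OneForm M) (x : M) (v : Fin 2 → TangentSpace (𝓡 3) x) :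
    dOne α x v = extDeriv (inChart α x) (extChartAt (𝓡 3) x x) (v : Fin 2 → E3) := by
  unfold dOne
  rw [mfderiv_extChartAt_self]
  rfl

/-- Differentiability of a 1-form at a point, tested on differentiable vector fields. In contrast
to differentiability as a section of the cotangent bundle, this passes directly to forms built from
`φ`, the metric and vector fields. -/
def OneForm.DiffAt (α : OneForm M) (x : M) : Prop :=
  ∀ X : VField M, X.DiffAt x → MDifferentiableAt (𝓡 3) 𝓘(ℝ, ℝ) (fun y => α y (X y)) x

theorem VField.diffAt_coordFrame {p x : M} (hx : x ∈ (extChartAt (𝓡 3) p).source) (i : Fin 3) :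
    VField.DiffAt (fun y => coordFrame p y i) x := by
  have : IsManifold (𝓡 3) 2 M := IsManifold.of_le (n := ∞) (by norm_cast)
  refine MDifferentiableAt.mpullback_vectorField (n := ∞) ?_ (contMDiffAt_extChartAt' ?_)
    (isInvertible_mfderiv_extChartAt hx) (by norm_cast)
  · exact (contMDiffAt_vectorSpace_iff_contDiffAt (n := 1)).2
      (contDiffAt_const (c := EuclideanSpace.single i (1 : ℝ))) |>.mdifferentiableAt one_ne_zero
  · simpa using hx

theorem inverse_apply_inverse_of_comp_eq_id {E F : Type*} [AddCommGroup E] [Module ℝ E]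
    [TopologicalSpace E] [AddCommGroup F] [Module ℝ F] [TopologicalSpace F] {A : F →L[ℝ] E}
    {B : E →L[ℝ] F} (hA : A.IsInvertible) (hB : B.IsInvertible)
    (h : A.comp B = ContinuousLinearMap.id ℝ E) (v : E) : B.inverse (A.inverse v) = v := by
  have h1 : A.inverse v = B v := by
    have h2 : A (B v) = v := congrArg (fun L : E →L[ℝ] E => L v) h
    rw [← hA.inverse_apply_self (B v), h2]
  rw [h1, hB.inverse_apply_self]

theorem vecInChart_coordFrame {p : M} {y : E3} (hy : y ∈ (extChartAt (𝓡 3) p).target) (i : Fin 3) :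
    vecInChart (fun y => coordFrame p y i) p y = EuclideanSpace.single i (1 : ℝ) := by
  have hA := isInvertible_mfderiv_extChartAt (𝕜 := ℝ) (I := 𝓡 3) (x := p)
    ((extChartAt (𝓡 3) p).map_target hy)
  have hB := isInvertible_mfderivWithin_extChartAt_symm (𝕜 := ℝ) (I := 𝓡 3) hy
  exact inverse_apply_inverse_of_comp_eq_id (E := E3) (F := E3)
    (B := mfderivWithin 𝓘(ℝ, E3) (𝓡 3) (extChartAt (𝓡 3) p).symm (range (𝓡 3)) y) hA hB
    (mfderiv_extChartAt_comp_mfderivWithin_extChartAt_symm hy) (EuclideanSpace.single i (1 : ℝ))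

omit [IsManifold (𝓡 3) ∞ M] in
theorem _root_.MDifferentiableAt.differentiableAt_comp_extChartAt_symm {f : M → ℝ} {x : M}
    (hf : MDifferentiableAt (𝓡 3) 𝓘(ℝ, ℝ) f x) :
    DifferentiableAt ℝ (f ∘ (extChartAt (𝓡 3) x).symm) (extChartAt (𝓡 3) x x) := by
  have h := ((mdifferentiableAt_iff f x).1 hf).2
  rw [ModelWithCorners.range_eq_univ] at h
  exact differentiableWithinAt_univ.1 h

/-- The coefficients of the chart expression of `α` are the functions `α(∂ᵢ)`. -/
theorem OneForm.DiffAt.differentiableAt_inChart {α : OneForm M} {x : M} (hα : α.DiffAt x) :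
    DifferentiableAt ℝ (inChart α x) (extChartAt (𝓡 3) x x) := by
  have h : inChart α x =ᶠ[𝓝 (extChartAt (𝓡 3) x x)] fun y => ∑ i : Fin 3,
      α ((extChartAt (𝓡 3) x).symm y) (coordFrame x ((extChartAt (𝓡 3) x).symm y) i) •
        ContinuousAlternatingMap.ofSubsingleton ℝ E3 ℝ (0 : Fin 1)
          (EuclideanSpace.proj i : E3 →L[ℝ] ℝ) := by
    filter_upwards [extChartAt_target_mem_nhds x] with y hy
    ext v
    have h1 (w : E3) : w = ∑ i, w i • vecInChart (fun y => coordFrame x y i) x y := by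
      simp_rw [vecInChart_coordFrame hy]
      ext k
      simp [Pi.single_apply]
    have h2 (w : Fin 1 → E3) : inChart α x y w = ∑ i, w 0 i •
        inChart α x y (fun _ => vecInChart (fun y => coordFrame x y i) x y) := by
      let f : E3 →ₗ[ℝ] ℝ :=
        { toFun := fun u => inChart α x y (fun _ => u)
          map_add' := fun a b => by simp [inChart]
          map_smul' := fun a b => by simp [inChart] }
      have h3 : inChart α x y w = f (w 0) := congrArg (inChart α x y) (by ext j; fin_cases j; rfl)
      rw [h3, h1 (w 0), map_sum]
      simp only [map_smul, ← h1 (w 0)]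
      rfl
    rw [h2]
    simp_rw [fun i => inChart_apply_vecInChart α (fun y => coordFrame x y i) x hy
      (fun _ => vecInChart (fun y => coordFrame x y i) x y) rfl]
    simp [mul_comm]
  refine DifferentiableAt.congr_of_eventuallyEq ?_ h
  refine DifferentiableAt.fun_sum fun i _ => DifferentiableAt.smul_const ?_ _
  exact (hα _ (VField.diffAt_coordFrame (mem_extChartAt_source x)
    i)).differentiableAt_comp_extChartAt_symm

/-- The invariant formula `dα(X, Y) = X α(Y) - Y α(X) - α([X, Y])`. -/
theorem dOne_apply {α : OneForm M} {X Y : VField M} {x : M} (hα : α.DiffAt x) (hX : X.DiffAt x)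
    (hY : Y.DiffAt x) :
    dOne α x ![X x, Y x] = deriveAlong X (fun y => α y (Y y)) x
      - deriveAlong Y (fun y => α y (X y)) x - α x (VectorField.mlieBracket (𝓡 3) X Y x) := by
  have hev (Z : VField M) (v : E3 → Fin 1 → E3) (hv : ∀ y, v y 0 = vecInChart Z x y) :
      (fun y => inChart α x y (v y)) =ᶠ[𝓝 (extChartAt (𝓡 3) x x)]
        (fun y => α y (Z y)) ∘ (extChartAt (𝓡 3) x).symm := by
    filter_upwards [extChartAt_target_mem_nhds x] with y hy
    exact inChart_apply_vecInChart α Z x hy _ (hv y)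
  -- Any tangent vector at `x` is the value of some vector field, which need not be differentiable.
  have hpt (w : E3) (v : Fin 1 → E3) (hv : v 0 = w) :
      inChart α x (extChartAt (𝓡 3) x x) v = α x (w : TangentSpace (𝓡 3) x) := by
    rw [inChart_apply_vecInChart α (fun _ => (w : E3)) x (mem_extChartAt_target x) v
      (hv.trans (vecInChart_self (fun _ => (w : E3)) x).symm)]
    exact congrArg (fun p => α p w) (extChartAt_to_inv x)
  have key := extDeriv_apply_vectorField (𝕜 := ℝ) (V := ![vecInChart X x, vecInChart Y x])
    hα.differentiableAt_inChart (fun i => by fin_cases i; exacts [hX.vecInChart, hY.vecInChart])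
  rw [Fin.sum_univ_two, Fin.sum_univ_one, (hev Y _ fun y => rfl).fderiv_eq,
    (hev X _ fun y => rfl).fderiv_eq] at key
  have h3 : (Finset.Ici (0 : Fin 1)) = {0} := rfl
  rw [h3, Finset.sum_singleton, hpt _ _ rfl] at key
  rw [dOne_apply_self, deriveAlong_eq_fderiv _ (hα Y hY), deriveAlong_eq_fderiv _ (hα X hX),
    mlieBracket_eq_lieBracket]
  have h4 : (fun i => (![vecInChart X x, vecInChart Y x] : Fin 2 → E3 → E3) i
      (extChartAt (𝓡 3) x x)) = ![X x, Y x] := by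
    ext1 i
    fin_cases i
    exacts [vecInChart_self X x, vecInChart_self Y x]
  rw [h4] at key
  refine key.trans ?_
  simp
  rfl

end ChartCalculus

/-! ### Algebra and regularity of almost contact structures -/

section LinearAlgebra

variable {V : Type*} [NormedAddCommGroup V] [InnerProductSpace ℝ V] [Fact (Module.finrank ℝ V = 3)]

theorem eq_zero_of_inner_eq_zero_of_orthogonal {u v w z : V} (hu : u ≠ 0) (hv : v ≠ 0) (hw : w ≠ 0)
    (huv : inner ℝ u v = 0) (huw : inner ℝ u w = 0) (hvw : inner ℝ v w = 0)
    (hzu : inner ℝ u z = 0) (hzv : inner ℝ v z = 0) (hzw : inner ℝ w z = 0) : z = 0 := by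
  have hli : LinearIndependent ℝ ![u, v, w] := by
    refine linearIndependent_of_ne_zero_of_inner_eq_zero ?_ ?_
    · intro i; fin_cases i <;> simpa
    · intro i j hij
      fin_cases i <;> fin_cases j <;> simp at hij ⊢ <;>
        first | assumption | (rw [real_inner_comm]; assumption)
  have hspan := hli.span_eq_top_of_card_eq_finrank (by
    rw [Fintype.card_fin, (Fact.out : Module.finrank ℝ V = 3)])
  have hz : z ∈ (Submodule.span ℝ (range ![u, v, w]))ᗮ := by
    rw [Submodule.mem_orthogonal]
    intro y hy
    induction hy using Submodule.span_induction with
    | mem y hy =>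
      obtain ⟨i, rfl⟩ := hy
      fin_cases i <;> simpa
    | zero => simp
    | add a b _ _ ha hb => rw [inner_add_left, ha, hb, add_zero]
    | smul r a _ ha => rw [inner_smul_left, ha, mul_zero]
  rw [hspan, Submodule.top_orthogonal_eq_bot] at hz
  simpa using hz
end LinearAlgebra

section Derivative

variable {M : Type*} [TopologicalSpace M] [ChartedSpace E3 M]

theorem deriveAlong_congr (X : VField M) {f g : M → ℝ} {x : M} (h : f =ᶠ[𝓝 x] g) :
    deriveAlong X f x = deriveAlong X g x := by
  have h1 : mvfderiv (𝓡 3) f x = mvfderiv (𝓡 3) g x := by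
    unfold mvfderiv
    rw [h.mfderiv_eq]
    rfl
  exact congrArg (fun L : E3 →L[ℝ] ℝ => L (X x)) h1

theorem deriveAlong_eq_zero (X : VField M) {f : M → ℝ} {x : M} {c : ℝ}
    (h : ∀ᶠ y in 𝓝 x, f y = c) : deriveAlong X f x = 0 := by
  rw [deriveAlong_congr X (g := fun _ => c) h]
  exact congrArg (fun L : E3 →L[ℝ] ℝ => L (X x)) (mvfderiv_const (I := 𝓡 3) c)

theorem deriveAlong_mul (X : VField M) {f g : M → ℝ} {x : M}
    (hf : MDifferentiableAt (𝓡 3) 𝓘(ℝ, ℝ) f x) (hg : MDifferentiableAt (𝓡 3) 𝓘(ℝ, ℝ) g x) :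
    deriveAlong X (f * g) x = f x * deriveAlong X g x + g x * deriveAlong X f x :=
  congrArg (fun L : E3 →L[ℝ] ℝ => L (X x)) (mvfderiv_mul hf hg)

theorem deriveAlong_add (X : VField M) {f g : M → ℝ} {x : M}
    (hf : MDifferentiableAt (𝓡 3) 𝓘(ℝ, ℝ) f x) (hg : MDifferentiableAt (𝓡 3) 𝓘(ℝ, ℝ) g x) :
    deriveAlong X (f + g) x = deriveAlong X f x + deriveAlong X g x :=
  congrArg (fun L : E3 →L[ℝ] ℝ => L (X x)) (mvfderiv_add hf hg)

end Derivative

section Smooth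

variable {M : Type*} [TopologicalSpace M] [ChartedSpace E3 M] [IsManifold (𝓡 3) ∞ M]

/-- Twice continuous differentiability of a vector field at a point. This open condition ensures that
Lie brackets are differentiable. -/
abbrev VField.C2At (X : VField M) (x : M) : Prop :=
  ContMDiffAt (𝓡 3) (𝓡 3).tangent 2 (fun y => (⟨y, X y⟩ : TangentBundle (𝓡 3) M)) x

theorem VField.C2At.diffAt {X : VField M} {x : M} (hX : X.C2At x) : X.DiffAt x :=
  hX.mdifferentiableAt two_ne_zero

theorem VField.C2At.eventually {X : VField M} {x : M} (hX : X.C2At x) : ∀ᶠ y in 𝓝 x, X.C2At y :=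
  (contMDiffAt_iff_contMDiffAt_nhds (by decide)).1 hX

theorem VField.DiffAt.congr {X Y : VField M} {x : M} (hX : X.DiffAt x)
    (h : ∀ᶠ y in 𝓝 x, Y y = X y) : Y.DiffAt x :=
  hX.congr_of_eventuallyEq (by filter_upwards [h] with y hy; rw [hy])

theorem VField.C2At.mlieBracket {X Y : VField M} {x : M} (hX : X.C2At x) (hY : Y.C2At x) :
    VField.DiffAt (VectorField.mlieBracket (𝓡 3) X Y) x := by
  have : IsManifold (𝓡 3) (((2 : ℕ∞) : WithTop ℕ∞) + 1) M :=
    IsManifold.of_le (n := ∞) (by norm_cast)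
  have : IsManifold (𝓡 3) (minSmoothness ℝ 2) M := by
    rw [minSmoothness_of_isRCLikeNormedField]
    exact IsManifold.of_le (n := ∞) (by norm_cast)
  refine (ContMDiffAt.mlieBracket_vectorField (m := 1) (n := 2) hX hY ?_).mdifferentiableAt
    one_ne_zero
  rw [minSmoothness_of_isRCLikeNormedField]
  norm_cast

theorem VField.C2At.sub {X Y : VField M} {x : M} (hX : X.C2At x) (hY : Y.C2At x) :
    VField.C2At (fun y => X y - Y y) x := ContMDiffAt.sub_section hX hY

theorem VField.C2At.smul {X : VField M} {f : M → ℝ} {x : M}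
    (hf : ContMDiffAt (𝓡 3) 𝓘(ℝ, ℝ) 2 f x) (hX : X.C2At x) :
    VField.C2At (fun y => f y • X y) x := ContMDiffAt.smul_section hf hX

theorem VField.DiffAt.add {X Y : VField M} {x : M} (hX : X.DiffAt x) (hY : Y.DiffAt x) :
    VField.DiffAt (fun y => X y + Y y) x := mdifferentiableAt_add_section hX hY

theorem VField.DiffAt.smul {X : VField M} {f : M → ℝ} {x : M}
    (hf : MDifferentiableAt (𝓡 3) 𝓘(ℝ, ℝ) f x) (hX : X.DiffAt x) :
    VField.DiffAt (fun y => f y • X y) x := MDifferentiableAt.smul_section hf hX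

theorem VField.c2At_extend {x : M} (v : TangentSpace (𝓡 3) x) :
    VField.C2At (FiberBundle.extend E3 v) x :=
  have : IsManifold (𝓡 3) (2 + 1) M := IsManifold.of_le (n := ∞) (by norm_cast)
  FiberBundle.contMDiffAt_extend (𝓡 3) E3 v

namespace AlmostContactStructure

variable (S : AlmostContactStructure M)

theorem diffAt_omega (x : M) : OneForm.DiffAt S.omega x := by
  intro X hX
  have h := MDifferentiableAt.clm_bundle_apply (F₁ := E3) (F₂ := ℝ) (b := id)
    (E₂ := Bundle.Trivial M ℝ) (ϕ := S.omega) (v := X)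
    (S.smooth_omega.mdifferentiable (by simp) x) hX
  exact ((mdifferentiableAt_totalSpace _ _).1 h).2

theorem contMDiffAt_omega {X : VField M} {x : M} (hX : X.C2At x) :
    ContMDiffAt (𝓡 3) 𝓘(ℝ, ℝ) 2 (fun y => S.omega y (X y)) x := by
  have h := ContMDiffAt.clm_bundle_apply (F₁ := E3) (F₂ := ℝ) (b := id)
    (E₂ := Bundle.Trivial M ℝ) (ϕ := S.omega) (v := X)
    ((S.smooth_omega x).of_le (by norm_cast)) hX
  exact ((contMDiffAt_totalSpace).1 h).2

theorem diffAt_phi {X : VField M} {x : M} (hX : X.DiffAt x) :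
    VField.DiffAt (fun y => S.phi y (X y)) x :=
  MDifferentiableAt.clm_bundle_apply (F₁ := E3) (F₂ := E3) (b := id)
    (E₁ := TangentSpace (𝓡 3)) (E₂ := TangentSpace (𝓡 3)) (ϕ := S.phi) (v := X)
    (S.smooth_phi.mdifferentiable (by simp) x) hX

theorem c2At_phi {X : VField M} {x : M} (hX : X.C2At x) :
    VField.C2At (fun y => S.phi y (X y)) x :=
  ContMDiffAt.clm_bundle_apply (F₁ := E3) (F₂ := E3) (b := id)
    (E₁ := TangentSpace (𝓡 3)) (E₂ := TangentSpace (𝓡 3)) (ϕ := S.phi) (v := X)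
    ((S.smooth_phi x).of_le (by norm_cast)) hX

theorem c2At_T (x : M) : S.T.C2At x := (S.smooth_T x).of_le (by norm_cast)

theorem phi_T (x : M) : S.phi x (S.T x) = 0 := by
  have h1 : S.phi x (S.phi x (S.T x)) = 0 := by rw [S.phi_phi, S.omega_T, one_smul, neg_add_cancel]
  have h2 := S.phi_phi x (S.phi x (S.T x))
  rw [h1, map_zero] at h2
  have h3 : S.phi x (S.T x) = S.omega x (S.phi x (S.T x)) • S.T x := by
    rw [← sub_eq_zero, ← neg_eq_zero, neg_sub, sub_eq_neg_add]; exact h2.symm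
  have h4 : (S.omega x (S.phi x (S.T x)) * S.omega x (S.phi x (S.T x))) • S.T x = 0 := by
    rw [mul_smul, ← h3, ← map_smul, ← h3, h1]
  have h5 := congrArg (S.omega x) h4
  rw [map_smul, S.omega_T, map_zero, smul_eq_mul, mul_one, mul_self_eq_zero] at h5
  rw [h3, h5, zero_smul]

theorem omega_phi (x : M) (v : TangentSpace (𝓡 3) x) : S.omega x (S.phi x v) = 0 := by
  have h2 := S.phi_phi x (S.phi x v)
  rw [S.phi_phi x v, map_add, map_neg, map_smul, S.phi_T, smul_zero, add_zero] at h2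
  have h3 := congrArg (S.omega x) (left_eq_add.1 h2)
  rwa [map_smul, S.omega_T, map_zero, smul_eq_mul, mul_one] at h3

theorem T_ne_zero (x : M) : S.T x ≠ 0 := fun h => by
  have := S.omega_T x
  rw [h, map_zero] at this
  exact zero_ne_one this

/-- Every point has a horizontal field that does not vanish there: subtract from an extension of a
vector independent of `T` its `T`-component. -/
theorem exists_horizontal (x : M) :
    ∃ E : VField M, E.C2At x ∧ (∀ y, S.omega y (E y) = 0) ∧ E x ≠ 0 := by
  obtain ⟨v, hv⟩ : ∃ v : TangentSpace (𝓡 3) x, v - S.omega x v • S.T x ≠ 0 := by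
    by_contra! h
    have h3 : Module.finrank ℝ (TangentSpace (𝓡 3) x) = 3 := Fact.out
    -- Otherwise `T` would span the tangent space.
    have := finrank_le_one (S.T x) (fun w => ⟨S.omega x w, (sub_eq_zero.1 (h w)).symm⟩)
    omega
  have hE := VField.c2At_extend v
  refine ⟨fun y => FiberBundle.extend E3 v y - S.omega y (FiberBundle.extend E3 v y) • S.T y,
    hE.sub ((S.c2At_T x).smul (S.contMDiffAt_omega hE)), fun y => ?_, ?_⟩
  · rw [map_sub, map_smul, S.omega_T, smul_eq_mul, mul_one, sub_self]
  · simpa using hv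

/-- On a horizontal field `Z` the two derivative terms of `dω(T, Z)` vanish, so that `η(Z)` involves
only a Lie bracket. -/
theorem eta_apply_of_omega_eq_zero {Z : VField M} (hZ : ∀ y, S.omega y (Z y) = 0) {x : M}
    (hZ' : Z.C2At x) :
    S.eta x (Z x) = - S.omega x (VectorField.mlieBracket (𝓡 3) S.T Z x) := by
  rw [eta, interiorProduct_apply, dOne_apply (S.diffAt_omega x) (S.c2At_T x).diffAt hZ'.diffAt,
    deriveAlong_eq_zero _ (f := fun y => S.omega y (S.T y)) (.of_forall S.omega_T),
    deriveAlong_eq_zero _ (f := fun y => S.omega y (Z y)) (.of_forall hZ)]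
  ring

end AlmostContactStructure

end Smooth

section Metric

variable {M : Type*} [TopologicalSpace M] [ChartedSpace E3 M] [IsManifold (𝓡 3) ∞ M]
  [RiemannianBundle (fun x : M => TangentSpace (𝓡 3) x)]

theorem mdifferentiableAt_metric
    [IsContMDiffRiemannianBundle (𝓡 3) ∞ E3 (fun x : M => TangentSpace (𝓡 3) x)]
    {X Y : VField M} {x : M} (hX : X.DiffAt x) (hY : Y.DiffAt x) :
    MDifferentiableAt (𝓡 3) 𝓘(ℝ, ℝ) (metric X Y) x :=
  have : IsContMDiffRiemannianBundle (𝓡 3) 1 E3 (fun x : M => TangentSpace (𝓡 3) x) :=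
    IsContMDiffRiemannianBundle.of_le (n := ∞) (by norm_cast)
  MDifferentiableAt.inner_bundle (IB := 𝓡 3) (F := E3) (b := id) hX hY

namespace AlmostContactStructure
variable {S : AlmostContactStructure M}

theorem IsCompatible.inner_T (hS : S.IsCompatible) (x : M) (v : TangentSpace (𝓡 3) x) :
    inner ℝ (S.T x) v = S.omega x v := by
  have := hS x (S.T x) v
  rw [S.phi_T, inner_zero_left, S.omega_T, one_mul] at this
  linarith

theorem IsCompatible.inner_phi (hS : S.IsCompatible) (x : M) (u v : TangentSpace (𝓡 3) x) :
    inner ℝ (S.phi x u) v = - inner ℝ u (S.phi x v) := by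
  have := hS x u (S.phi x v)
  rw [S.phi_phi, S.omega_phi, inner_add_right, inner_neg_right, inner_smul_right,
    real_inner_comm (S.T x), hS.inner_T, S.omega_phi] at this
  linarith

theorem IsCompatible.inner_T_phi (hS : S.IsCompatible) (x : M) (v : TangentSpace (𝓡 3) x) :
    inner ℝ (S.T x) (S.phi x v) = 0 := by
  rw [hS.inner_T, S.omega_phi]

theorem IsCompatible.inner_self_phi (hS : S.IsCompatible) (x : M) (v : TangentSpace (𝓡 3) x) :
    inner ℝ v (S.phi x v) = 0 := by
  have := hS.inner_phi x v v
  rw [real_inner_comm] at this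
  linarith

theorem IsCompatible.inner_phi_phi (hS : S.IsCompatible) {x : M} {v : TangentSpace (𝓡 3) x}
    (hv : S.omega x v = 0) : inner ℝ (S.phi x v) (S.phi x v) = inner ℝ v v := by
  rw [hS, hv, mul_zero, sub_zero]

/-- For horizontal `v ≠ 0` the vectors `T`, `v`, `φv` form an orthogonal frame, and inner products
with them determine a vector. -/
theorem IsCompatible.eq_of_inner_eq (hS : S.IsCompatible) {x : M} {v a b : TangentSpace (𝓡 3) x}
    (hv : v ≠ 0) (hv0 : S.omega x v = 0) (h1 : inner ℝ (S.T x) a = inner ℝ (S.T x) b)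
    (h2 : inner ℝ v a = inner ℝ v b) (h3 : inner ℝ (S.phi x v) a = inner ℝ (S.phi x v) b) :
    a = b := by
  rw [← sub_eq_zero]
  have hpv : S.phi x v ≠ 0 := fun h => hv (by
    rw [← inner_self_eq_zero (𝕜 := ℝ), ← hS.inner_phi_phi hv0, h, inner_zero_left])
  refine eq_zero_of_inner_eq_zero_of_orthogonal (S.T_ne_zero x) hv hpv ?_
    (hS.inner_T_phi x v) (hS.inner_self_phi x v) ?_ ?_ ?_
  · rw [hS.inner_T, hv0]
  · rw [inner_sub_right, h1, sub_self]
  · rw [inner_sub_right, h2, sub_self]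
  · rw [inner_sub_right, h3, sub_self]

end AlmostContactStructure

end Metric

/-! ### The Levi-Civita connection -/

section LeviCivita

variable {M : Type*} [TopologicalSpace M] [ChartedSpace E3 M]
  [IsManifold (𝓡 3) ∞ M]

theorem mlieBracket_smul_right' (X : VField M) {Z : VField M} {f : M → ℝ} {x : M}
    (hf : MDifferentiableAt (𝓡 3) 𝓘(ℝ, ℝ) f x) (hZ : Z.DiffAt x) :
    VectorField.mlieBracket (𝓡 3) X (f • Z) x =
      deriveAlong X f x • Z x + f x • VectorField.mlieBracket (𝓡 3) X Z x :=
  have : IsManifold (𝓡 3) 2 M := IsManifold.of_le (n := ∞) (by norm_cast)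
  VectorField.mlieBracket_smul_right hf hZ

theorem mlieBracket_add_right' (X : VField M) {Z Z' : VField M} {x : M}
    (hZ : Z.DiffAt x) (hZ' : Z'.DiffAt x) :
    VectorField.mlieBracket (𝓡 3) X (Z + Z') x =
      VectorField.mlieBracket (𝓡 3) X Z x + VectorField.mlieBracket (𝓡 3) X Z' x :=
  have : IsManifold (𝓡 3) 2 M := IsManifold.of_le (n := ∞) (by norm_cast)
  VectorField.mlieBracket_add_right hZ hZ'

variable [RiemannianBundle (fun x : M => TangentSpace (𝓡 3) x)]
  [IsContMDiffRiemannianBundle (𝓡 3) ∞ E3 (fun x : M => TangentSpace (𝓡 3) x)]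

/-- The Koszul formula is tensorial in its last argument, so that the extensions of the basis
vectors used in the definition of `nabla` do not matter. -/
theorem tensorialAt_koszul {X Y : VField M} {x : M} (hX : X.DiffAt x) (hY : Y.DiffAt x) :
    TensorialAt (𝓡 3) E3 (fun Z : VField M => koszul X Y Z x) x where
  smul {f Z} hf hZ := by
    have h1 (U : VField M) : metric U (f • Z) = f * metric U Z := by
      ext y; exact inner_smul_right _ _ _
    simp only [koszul, h1, deriveAlong_mul _ hf (mdifferentiableAt_metric hX hZ),
      deriveAlong_mul _ hf (mdifferentiableAt_metric hY hZ), smul_eq_mul]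
    simp only [metric, mlieBracket_smul_right' _ hf hZ, inner_add_left,
      inner_smul_left, Pi.mul_apply]
    have h3 : deriveAlong (f • Z) (fun y => inner ℝ (X y) (Y y)) x =
      f x * deriveAlong Z (fun y => inner ℝ (X y) (Y y)) x :=
      map_smul (mvfderiv (𝓡 3) (fun y => inner ℝ (X y) (Y y)) x) (f x) (Z x)
    unfold metric
    rw [h3]
    simp only [real_inner_comm (Z x), RCLike.conj_to_real]
    ring
  add {Z Z'} hZ hZ' := by
    have h1 (U : VField M) : metric U (Z + Z') = metric U Z + metric U Z' := by
      ext y; exact inner_add_right _ _ _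
    have h3 : deriveAlong (Z + Z') (metric X Y) x =
        deriveAlong Z (metric X Y) x + deriveAlong Z' (metric X Y) x :=
      map_add (mvfderiv (𝓡 3) (metric X Y) x) (Z x) (Z' x)
    simp only [koszul, h1, h3,
      deriveAlong_add _ (mdifferentiableAt_metric hX hZ) (mdifferentiableAt_metric hX hZ'),
      deriveAlong_add _ (mdifferentiableAt_metric hY hZ) (mdifferentiableAt_metric hY hZ')]
    simp only [metric, mlieBracket_add_right' _ hZ hZ', inner_add_left, Pi.add_apply]
    ring

/-- The characteristic property of the Levi-Civita connection: `⟨∇_X Y, Z⟩` is given by the Koszul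
formula. -/
theorem metric_nabla {X Y Z : VField M} {x : M} (hX : X.DiffAt x) (hY : Y.DiffAt x)
    (hZ : Z.DiffAt x) : metric (nabla X Y) Z x = koszul X Y Z x := by
  have : IsManifold (𝓡 3) 1 M := IsManifold.of_le (n := ∞) (by norm_cast)
  have hT := tensorialAt_koszul hX hY
  have h1 (v : TangentSpace (𝓡 3) x) :
      koszul X Y (FiberBundle.extend E3 v) x = TensorialAt.mkHom _ x hT v := rfl
  rw [← hT.mkHom_apply hZ]
  unfold metric nabla
  simp_rw [h1]
  rw [sum_inner]
  nth_rewrite 2 [← (stdOrthonormalBasis ℝ (TangentSpace (𝓡 3) x)).sum_repr' (Z x)]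
  rw [map_sum]
  simp only [map_smul, inner_smul_left, smul_eq_mul, RCLike.conj_to_real, mul_comm]

omit [IsManifold (𝓡 3) ∞ M]
  [IsContMDiffRiemannianBundle (𝓡 3) ∞ E3 (fun x : M => TangentSpace (𝓡 3) x)] in
/-- For pairwise orthogonal fields, `⟨∇_Y Z, X⟩ - ⟨∇_X Z, Y⟩ = ⟨∇_X Y - ∇_Y X, Z⟩ = ⟨[X, Y], Z⟩`. -/
theorem koszul_sub_koszul {X Y Z : VField M} {x : M}
    (hXY : ∀ᶠ y in 𝓝 x, metric X Y y = 0)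
    (hYZ : ∀ᶠ y in 𝓝 x, metric Y Z y = 0) (hXZ : ∀ᶠ y in 𝓝 x, metric X Z y = 0) :
    koszul Y Z X x - koszul X Z Y x = metric (VectorField.mlieBracket (𝓡 3) X Y) Z x := by
  have hc (U V : VField M) : metric U V = metric V U := by
    ext y; exact real_inner_comm _ _
  have hb (U V W : VField M) : metric (VectorField.mlieBracket (𝓡 3) U V) W x =
    - metric (VectorField.mlieBracket (𝓡 3) V U) W x := by
    unfold metric
    rw [VectorField.mlieBracket_swap_apply, inner_neg_left]
  simp only [koszul, hc Z X, hc Y X, hc Z Y, deriveAlong_eq_zero _ hXY, deriveAlong_eq_zero _ hYZ,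
    deriveAlong_eq_zero _ hXZ, hb Y X Z, hb Z X Y, hb Z Y X]
  ring

end LeviCivita

/-! ### The acceleration field of the `T`-curves -/

section Normal

variable {M : Type*} [TopologicalSpace M] [ChartedSpace E3 M] [IsManifold (𝓡 3) ∞ M]

variable [RiemannianBundle (fun x : M => TangentSpace (𝓡 3) x)]
  [IsContMDiffRiemannianBundle (𝓡 3) ∞ E3 (fun x : M => TangentSpace (𝓡 3) x)]

namespace AlmostContactStructure
variable {S : AlmostContactStructure M}

/-- `η` is the metric dual of the acceleration `∇_T T`. -/
theorem eta_apply (hS : S.IsCompatible) (x : M) (v : TangentSpace (𝓡 3) x) :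
    S.eta x v = inner ℝ (nabla S.T S.T x) v := by
  have hT := (S.c2At_T x).diffAt
  have hZ := (VField.c2At_extend v).diffAt
  have hv : FiberBundle.extend E3 v x = v := by simp
  have h1 := metric_nabla hT hT hZ
  have h2 := dOne_apply (S.diffAt_omega x) hT hZ
  have h3 : metric (nabla S.T S.T) (FiberBundle.extend E3 v) x = inner ℝ (nabla S.T S.T x) v := by
    unfold metric; rw [hv]
  have h4 (Z : VField M) : metric S.T Z = fun y => S.omega y (Z y) := by
    ext y; exact hS.inner_T y _
  have h5 (Z : VField M) : metric Z S.T = fun y => S.omega y (Z y) := by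
    ext y; exact (real_inner_comm _ _).trans (hS.inner_T y _)
  rw [h3, koszul, h5, h5, h4, VectorField.mlieBracket_self] at h1
  rw [hv, deriveAlong_eq_zero _ (f := fun y => S.omega y (S.T y)) (.of_forall S.omega_T)] at h2
  rw [deriveAlong_eq_zero _ (f := fun y => S.omega y (S.T y)) (.of_forall S.omega_T)] at h1
  have h6 : metric (0 : VField M) (FiberBundle.extend E3 v) x = 0 := inner_zero_left _
  rw [h6] at h1
  rw [eta, interiorProduct_apply, h2, h1]
  ring

theorem omega_nabla (hS : S.IsCompatible) (x : M) : S.omega x (nabla S.T S.T x) = 0 := by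
  rw [← hS.inner_T, real_inner_comm, ← eta_apply hS, eta, interiorProduct_apply]
  exact (dOne S.omega x).map_eq_zero_of_eq ![S.T x, S.T x] (i := 0) (j := 1) rfl (by decide)

/-- The acceleration field `∇_T T` is differentiable: it is the metric dual of `η`, and in a frame
`(T, E, φE)` with `E` horizontal its components are expressed through Lie brackets. -/
theorem diffAt_nabla (hS : S.IsCompatible) (x : M) : VField.DiffAt (nabla S.T S.T) x := by
  obtain ⟨E, hE, hE0, hEx⟩ := S.exists_horizontal x
  have hF := S.c2At_phi hE
  set F : VField M := fun y => S.phi y (E y) with hFdef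
  have hF0 : ∀ y, S.omega y (F y) = 0 := fun y => S.omega_phi y _
  -- By `eta_apply_of_omega_eq_zero`, this function is `η(Z)` if `Z` is horizontal.
  have hc {Z : VField M} (hZ : Z.C2At x) : MDifferentiableAt (𝓡 3) 𝓘(ℝ, ℝ)
      (fun y => - S.omega y (VectorField.mlieBracket (𝓡 3) S.T Z y)) x :=
    (S.diffAt_omega x _ ((S.c2At_T x).mlieBracket hZ)).neg
  have hq := mdifferentiableAt_metric hE.diffAt hE.diffAt
  have hq0 : metric E E x ≠ 0 := fun h => hEx (inner_self_eq_zero.1 h)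
  have hqi : MDifferentiableAt (𝓡 3) 𝓘(ℝ, ℝ) (fun y => (metric E E y)⁻¹) x :=
    (differentiableAt_inv hq0).mdifferentiableAt.comp x hq
  refine VField.DiffAt.congr (VField.DiffAt.smul hqi
    ((hE.diffAt.smul (hc hE)).add (hF.diffAt.smul (hc hF)))) ?_
  filter_upwards [hE.eventually, hF.eventually, hq.continuousAt.eventually_ne hq0] with y h1 h2 h3
  have hEy : E y ≠ 0 := fun h => h3 (by rw [metric, h, inner_zero_left])
  rw [← S.eta_apply_of_omega_eq_zero hE0 h1, ← S.eta_apply_of_omega_eq_zero hF0 h2, eta_apply hS,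
    eta_apply hS]
  have hEF : inner ℝ (E y) (F y) = 0 := hS.inner_self_phi y (E y)
  have hFF : inner ℝ (F y) (F y) = metric E E y := hS.inner_phi_phi (hE0 y)
  refine hS.eq_of_inner_eq hEy (hE0 y) ?_ ?_ ?_
  · rw [inner_smul_right, inner_add_right, inner_smul_right, inner_smul_right, hS.inner_T,
      hS.inner_T, hS.inner_T, hE0, hF0, omega_nabla hS]
    ring
  · rw [inner_smul_right, inner_add_right, inner_smul_right, inner_smul_right, hEF, real_inner_comm]
    change _ = (metric E E y)⁻¹ * (_ * metric E E y + _)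
    field_simp
    ring
  · change inner ℝ (F y) _ = inner ℝ (F y) _
    rw [inner_smul_right, inner_add_right, inner_smul_right, inner_smul_right, hFF,
      real_inner_comm (E y) (F y), hEF, real_inner_comm]
    field_simp
    ring

theorem diffAt_etaStar (hS : S.IsCompatible) (x : M) : OneForm.DiffAt S.etaStar x := by
  intro Y hY
  have h : (fun y => S.etaStar y (Y y)) = metric (nabla S.T S.T) (fun y => S.phi y (Y y)) := by
    ext y; exact eta_apply hS y _
  rw [h]
  exact mdifferentiableAt_metric (diffAt_nabla hS x) (S.diffAt_phi hY)

theorem diffAt_normal (hS : S.IsCompatible) {x : M} (hx : nabla S.T S.T x ≠ 0) :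
    (normal S.T).DiffAt x := by
  have hq := mdifferentiableAt_metric (diffAt_nabla hS x) (diffAt_nabla hS x)
  have hq0 : metric (nabla S.T S.T) (nabla S.T S.T) x ≠ 0 := fun h => hx (inner_self_eq_zero.1 h)
  have h : (curv S.T) = Real.sqrt ∘ (metric (nabla S.T S.T) (nabla S.T S.T)) := by
    ext y; exact norm_eq_sqrt_real_inner _
  have h1 : MDifferentiableAt (𝓡 3) 𝓘(ℝ, ℝ) (curv S.T) x := by
    rw [h]
    exact (Real.hasDerivAt_sqrt hq0).differentiableAt.mdifferentiableAt.comp x hq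
  have h2 : MDifferentiableAt (𝓡 3) 𝓘(ℝ, ℝ) (fun y => (curv S.T y)⁻¹) x :=
    (differentiableAt_inv (norm_ne_zero_iff.2 hx)).mdifferentiableAt.comp x h1
  exact (diffAt_nabla hS x).smul h2

end AlmostContactStructure

end Normal

/-! ### Volume form and orientation -/

section VolumeForm

variable {V : Type*} [NormedAddCommGroup V] [InnerProductSpace ℝ V] [Fact (Module.finrank ℝ V = 3)]
  (o : Orientation ℝ V (Fin 3))

/-- The Gram determinant is the square of the volume form. -/
theorem det_gram_eq_volumeForm_sq (v : Fin 3 → V) :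
    Matrix.det (Matrix.of fun i j : Fin 3 => inner ℝ (v i) (v j)) = o.volumeForm v ^ 2 := by
  have hd : Module.finrank ℝ V = 3 := Fact.out
  have : FiniteDimensional ℝ V := Module.finite_of_finrank_eq_succ hd
  let b := (stdOrthonormalBasis ℝ V).reindex (finCongr hd)
  rw [← sq_abs, o.volumeForm_robust' b, sq_abs, Module.Basis.det_apply, pow_two]
  nth_rewrite 1 [← Matrix.det_transpose (b.toBasis.toMatrix v)]
  rw [← Matrix.det_mul]
  congr 1
  ext i j
  simp only [Matrix.of_apply, Matrix.mul_apply, Matrix.transpose_apply, Module.Basis.toMatrix_apply,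
    OrthonormalBasis.coe_toBasis_repr_apply, OrthonormalBasis.repr_apply_apply]
  rw [← b.sum_inner_mul_inner]
  simp [real_inner_comm]

/-- A 3-form is a multiple of the volume form, the factor being its value on any positively
oriented orthonormal frame. -/
theorem alternatingMap_apply_eq_mul_volumeForm (α : V [⋀^Fin 3]→ₗ[ℝ] ℝ) {e : Fin 3 → V}
    (he : o.volumeForm e = 1) (v : Fin 3 → V) : α v = α e * o.volumeForm v := by
  have hli : LinearIndependent ℝ e := by
    by_contra h
    rw [AlternatingMap.map_linearDependent o.volumeForm e h] at he
    exact zero_ne_one he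
  let b := basisOfLinearIndependentOfCardEqFinrank hli (by
    rw [Fintype.card_fin, (Fact.out : Module.finrank ℝ V = 3)])
  have hb : (b : Fin 3 → V) = e := coe_basisOfLinearIndependentOfCardEqFinrank _ _
  rw [α.eq_smul_basis_det b, o.volumeForm.eq_smul_basis_det b, hb, he]
  simp [Module.Basis.det_apply, ← hb]

/-- An orientation is the ray of its volume form, hence any representative has the same signs. -/
theorem sign_someVector (v : Fin 3 → V) :
    (SignType.sign (o.someVector v) : SignType) = SignType.sign (o.volumeForm v) := by
  have hd : Module.finrank ℝ V = 3 := Fact.out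
  have : FiniteDimensional ℝ V := Module.finite_of_finrank_eq_succ hd
  let b := o.finOrthonormalBasis (by norm_num) hd
  have hb : b.toBasis.orientation = o := o.finOrthonormalBasis_orientation _ hd
  have hr : SameRay ℝ o.someVector b.toBasis.det := by
    rw [← ray_eq_iff o.someVector_ne_zero b.toBasis.det_ne_zero, o.someVector_ray, ← hb]
    rfl
  obtain ⟨r, s, hr0, hs0, h⟩ := hr.exists_pos o.someVector_ne_zero b.toBasis.det_ne_zero
  rw [o.volumeForm_robust b hb]
  have h1 : r * o.someVector v = s * b.toBasis.det v := by
    simpa using congrArg (fun f : V [⋀^Fin 3]→ₗ[ℝ] ℝ => f v) h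
  have h2 : SignType.sign (r * o.someVector v) = SignType.sign (s * b.toBasis.det v) := by rw [h1]
  rwa [sign_mul, sign_mul, sign_pos hr0, sign_pos hs0, one_mul, one_mul] at h2

end VolumeForm

section Orientation

variable {M : Type*} [TopologicalSpace M] [ChartedSpace E3 M] [IsManifold (𝓡 3) ∞ M]

omit [IsManifold (𝓡 3) ∞ M] in
/-- The differential at `x` of the chart at `p`, with values in `ℝ³`: for `x` in the
domain of the chart, it maps a tangent vector to its components in the coordinate frame. -/
def chartDeriv (p x : M) : TangentSpace (𝓡 3) x →L[ℝ] E3 :=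
  mfderiv (𝓡 3) 𝓘(ℝ, E3) (extChartAt (𝓡 3) p) x

theorem isInvertible_chartDeriv {p x : M} (hx : x ∈ (extChartAt (𝓡 3) p).source) :
    (chartDeriv p x).IsInvertible :=
  isInvertible_mfderiv_extChartAt (𝕜 := ℝ) (I := 𝓡 3) hx

theorem chartDeriv_coordFrame {p x : M} (hx : x ∈ (extChartAt (𝓡 3) p).source) (i : Fin 3) :
    chartDeriv p x (coordFrame p x i) = EuclideanSpace.single i (1 : ℝ) :=
  (isInvertible_chartDeriv hx).self_apply_inverse _

/-- The components of a vector field in the coordinate frame of a chart are continuous. -/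
theorem VField.DiffAt.continuousAt_chartDeriv {X : VField M} {x : M} (hX : X.DiffAt x) :
    ContinuousAt (fun y => chartDeriv x y (X y)) x := by
  have : IsManifold (𝓡 3) 1 M := IsManifold.of_le (n := ∞) (by norm_cast)
  have h := ((mdifferentiableAt_totalSpace _ _).1 hX).2.continuousAt
  refine h.congr ?_
  filter_upwards [(chartAt E3 x).open_source.mem_nhds (mem_chart_source E3 x)] with y hy
  have h1 := TangentBundle.continuousLinearMapAt_trivializationAt (𝕜 := ℝ) (I := 𝓡 3) hy
  have h2 := congrArg (fun L : E3 →L[ℝ] E3 => L (X y)) h1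
  refine Eq.trans ?_ h2
  exact (Trivialization.continuousLinearMapAt_apply_of_mem (R := ℝ)
    (e := trivializationAt E3 (TangentSpace (𝓡 3)) x) hy (X y)).symm

variable [RiemannianBundle (fun x : M => TangentSpace (𝓡 3) x)]

omit [IsManifold (𝓡 3) ∞ M] in
theorem orientationSign_eq (o : ManifoldOrientation M) (x : M) (v : Fin 3 → TangentSpace (𝓡 3) x) :
    orientationSign (o.at' x) v = SignType.sign ((o.at' x).volumeForm v) := by
  rw [orientationSign]
  exact congrArg _ (sign_someVector (o.at' x) v)

theorem volumeForm_apply_eq_det_mul (o : ManifoldOrientation M) {p x : M}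
    (hx : x ∈ (extChartAt (𝓡 3) p).source) (v : Fin 3 → TangentSpace (𝓡 3) x) :
    (o.at' x).volumeForm v = Matrix.det (Matrix.of fun i j =>
      chartDeriv p x (v j) i) *
        (o.at' x).volumeForm (coordFrame p x) := by
  obtain ⟨e, he⟩ := isInvertible_chartDeriv hx
  let b := (EuclideanSpace.basisFun (Fin 3) ℝ).toBasis.map e.symm.toLinearEquiv
  have hb : (b : Fin 3 → TangentSpace (𝓡 3) x) = coordFrame p x := by
    ext1 i
    apply e.injective
    have h1 := chartDeriv_coordFrame hx i
    rw [← he] at h1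
    refine Eq.trans ?_ h1.symm
    simp [b]
  have hm : b.toMatrix v = Matrix.of fun i j => chartDeriv p x (v j) i := by
    ext i j
    rw [← he]
    simp [b, Module.Basis.toMatrix_apply]
  rw [(o.at' x).volumeForm.eq_smul_basis_det b, hb, ← hm, ← hb]
  simp [Module.Basis.det_apply, mul_comm]

/-- A frame of differentiable vector fields has locally constant sign. -/
theorem eventually_sign_volumeForm_eq (o : ManifoldOrientation M) {X : Fin 3 → VField M} {x : M}
    (hX : ∀ i, (X i).DiffAt x) (h0 : (o.at' x).volumeForm (fun i => X i x) ≠ 0) :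
    ∀ᶠ y in 𝓝 x, SignType.sign ((o.at' y).volumeForm (fun i => X i y)) =
      SignType.sign ((o.at' x).volumeForm (fun i => X i x)) := by
  let A (y : M) : Matrix (Fin 3) (Fin 3) ℝ := Matrix.of fun i j =>
      chartDeriv x y (X j y) i
  have hA : ContinuousAt A x := by
    refine continuousAt_pi.2 fun i => continuousAt_pi.2 fun j => ?_
    exact (EuclideanSpace.proj i : E3 →L[ℝ] ℝ).continuous.continuousAt.comp
      (hX j).continuousAt_chartDeriv
  have hdet : ContinuousAt (fun y => (A y).det) x :=
    (continuous_id.matrix_det).continuousAt.comp hA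
  rw [volumeForm_apply_eq_det_mul o (mem_extChartAt_source x)] at h0
  have hs : ∀ᶠ y in 𝓝 x, SignType.sign (A y).det = SignType.sign (A x).det := by
    have h1 : ContinuousAt SignType.sign (A x).det :=
      continuousAt_sign_of_ne_zero (left_ne_zero_of_mul h0)
    have h2 : ContinuousAt (fun y => SignType.sign (A y).det) x :=
      ContinuousAt.comp (f := fun y => (A y).det) h1 hdet
    exact h2.eventually_mem ((isOpen_discrete _).mem_nhds (mem_singleton _))
  filter_upwards [hs, o.locallyConstant x x (mem_extChartAt_source x),
    extChartAt_source_mem_nhds (I := 𝓡 3) x] with y h1 h2 h3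
  rw [volumeForm_apply_eq_det_mul o h3, volumeForm_apply_eq_det_mul o (mem_extChartAt_source x),
    sign_mul, sign_mul]
  rw [orientationSign_eq, orientationSign_eq] at h2
  congr 1
  -- The two signs agree as real numbers; it remains to remove the cast.
  generalize SignType.sign ((o.at' y).volumeForm (coordFrame x y)) = a at h2 ⊢
  generalize SignType.sign ((o.at' x).volumeForm (coordFrame x x)) = b at h2 ⊢
  cases a <;> cases b <;> simp at h2 ⊢ <;> norm_num at h2

end Orientation

/-! ### The Frenet frame and the pointwise identity -/

section Binormal

variable {M : Type*} [TopologicalSpace M] [ChartedSpace E3 M] [IsManifold (𝓡 3) ∞ M]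
  [RiemannianBundle (fun x : M => TangentSpace (𝓡 3) x)]

omit [IsManifold (𝓡 3) ∞ M] in
theorem inner_cross (o : ManifoldOrientation M) (X Y : VField M) (x : M)
    (v : TangentSpace (𝓡 3) x) :
    inner ℝ (cross o X Y x) v = (o.at' x).volumeForm ![X x, Y x, v] := by
  let L : TangentSpace (𝓡 3) x →ₗ[ℝ] ℝ :=
    (o.at' x).volumeForm.toMultilinearMap.toLinearMap ![X x, Y x, 0] 2
  have hL (w : TangentSpace (𝓡 3) x) : (o.at' x).volumeForm ![X x, Y x, w] = L w := by
    have h : Function.update ![X x, Y x, 0] 2 w = ![X x, Y x, w] := by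
      ext1 i; fin_cases i <;> simp
    change _ = (o.at' x).volumeForm (Function.update ![X x, Y x, 0] 2 w)
    rw [h]
  rw [cross, hL, sum_inner]
  nth_rewrite 2 [← (stdOrthonormalBasis ℝ (TangentSpace (𝓡 3) x)).sum_repr' v]
  rw [map_sum]
  simp only [map_smul, inner_smul_left, smul_eq_mul, RCLike.conj_to_real, mul_comm, hL]

variable (S : AlmostContactStructure M)

theorem inner_normal_self {x : M} (hx : nabla S.T S.T x ≠ 0) :
    inner ℝ (normal S.T x) (normal S.T x) = (1 : ℝ) := by
  have : ‖normal S.T x‖ = 1 := by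
    rw [normal, curv, norm_smul, norm_inv, norm_norm, inv_mul_cancel₀ (norm_ne_zero_iff.2 hx)]
  rw [real_inner_self_eq_norm_sq, this, one_pow]

theorem curv_smul_normal {T : VField M} {x : M} (hx : nabla T T x ≠ 0) :
    curv T x • normal T x = nabla T T x := by
  rw [normal, curv, smul_smul, mul_inv_cancel₀ (norm_ne_zero_iff.2 hx), one_smul]

/-- The volume of the frame `(T, N, φN)`, which is `1` or `-1` where `∇_T T ≠ 0`. -/
def frameSign (o : ManifoldOrientation M) (S : AlmostContactStructure M) (x : M) : ℝ :=
  (o.at' x).volumeForm ![S.T x, normal S.T x, S.phi x (normal S.T x)]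

variable {S} [IsContMDiffRiemannianBundle (𝓡 3) ∞ E3 (fun x : M => TangentSpace (𝓡 3) x)]

namespace AlmostContactStructure.IsCompatible

theorem omega_normal (hS : S.IsCompatible) (x : M) : S.omega x (normal S.T x) = 0 := by
  rw [normal, map_smul, omega_nabla hS, smul_zero]

theorem binormal_eq (hS : S.IsCompatible) (o : ManifoldOrientation M) {x : M}
    (hx : nabla S.T S.T x ≠ 0) :
    binormal o S.T x = frameSign o S x • S.phi x (normal S.T x) := by
  have hN := inner_normal_self S hx
  have hN0 : normal S.T x ≠ 0 := fun h => by
    rw [h, inner_zero_left] at hN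
    exact zero_ne_one hN
  refine hS.eq_of_inner_eq hN0 (hS.omega_normal x) ?_ ?_ ?_
  · rw [real_inner_comm, binormal, inner_cross, inner_smul_right, hS.inner_T_phi, mul_zero]
    exact (o.at' x).volumeForm.map_eq_zero_of_eq _ (i := 0) (j := 2) rfl (by decide)
  · rw [real_inner_comm, binormal, inner_cross, inner_smul_right, hS.inner_self_phi, mul_zero]
    exact (o.at' x).volumeForm.map_eq_zero_of_eq _ (i := 1) (j := 2) rfl (by decide)
  · rw [real_inner_comm, binormal, inner_cross, inner_smul_right,
      hS.inner_phi_phi (hS.omega_normal x), hN, mul_one, frameSign]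

theorem frameSign_eq (hS : S.IsCompatible) (o : ManifoldOrientation M) {x : M}
    (hx : nabla S.T S.T x ≠ 0) : frameSign o S x = 1 ∨ frameSign o S x = -1 := by
  have hN := inner_normal_self S hx
  rw [← abs_eq zero_le_one]
  have hTN : inner ℝ (S.T x) (normal S.T x) = 0 := by rw [hS.inner_T, hS.omega_normal]
  have h := (o.at' x).abs_volumeForm_apply_of_pairwise_orthogonal
    (v := ![S.T x, normal S.T x, S.phi x (normal S.T x)]) (by
      intro i j hij
      fin_cases i <;> fin_cases j <;> simp at hij ⊢ <;>
        first
          | exact hTN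
          | exact hS.inner_T_phi x _
          | exact hS.inner_self_phi x _
          | (rw [real_inner_comm]; first
              | exact hTN
              | exact hS.inner_T_phi x _
              | exact hS.inner_self_phi x _))
  rw [frameSign, h, Fin.prod_univ_three]
  have h1 : ‖S.T x‖ = 1 := by
    rw [norm_eq_sqrt_real_inner, hS.inner_T, S.omega_T, Real.sqrt_one]
  have h2 : ‖normal S.T x‖ = 1 := by rw [norm_eq_sqrt_real_inner, hN, Real.sqrt_one]
  have h3 : ‖S.phi x (normal S.T x)‖ = 1 := by
    rw [norm_eq_sqrt_real_inner, hS.inner_phi_phi (hS.omega_normal x), hN, Real.sqrt_one]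
  simp [h1, h2, h3]

theorem inner_binormal_self (hS : S.IsCompatible) (o : ManifoldOrientation M) {x : M}
    (hx : nabla S.T S.T x ≠ 0) : inner ℝ (binormal o S.T x) (binormal o S.T x) = (1 : ℝ) := by
  rw [hS.binormal_eq o hx, inner_smul_left, inner_smul_right,
    hS.inner_phi_phi (hS.omega_normal x), inner_normal_self S hx]
  rcases hS.frameSign_eq o hx with h | h <;> simp [h]

theorem eventually_nabla_ne_zero (hS : S.IsCompatible) {x : M} (hx : nabla S.T S.T x ≠ 0) :
    ∀ᶠ y in 𝓝 x, nabla S.T S.T y ≠ 0 := by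
  have hq := mdifferentiableAt_metric (diffAt_nabla hS x) (diffAt_nabla hS x)
  have hq0 : metric (nabla S.T S.T) (nabla S.T S.T) x ≠ 0 := fun h => hx (inner_self_eq_zero.1 h)
  filter_upwards [hq.continuousAt.eventually_ne hq0] with y hy h
  exact hy (by rw [metric, h, inner_zero_left])

/-- The sign relating `B` to `φN` is locally constant, whence `B` is as regular as `φN`. -/
theorem eventually_frameSign_eq (hS : S.IsCompatible) (o : ManifoldOrientation M) {x : M}
    (hx : nabla S.T S.T x ≠ 0) : ∀ᶠ y in 𝓝 x, frameSign o S y = frameSign o S x := by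
  have hN := diffAt_normal hS hx
  have hvec (y : M) : (fun i => (![S.T, normal S.T, fun y => S.phi y (normal S.T y)] :
      Fin 3 → VField M) i y) = ![S.T y, normal S.T y, S.phi y (normal S.T y)] := by
    ext1 i; fin_cases i <;> rfl
  have h := eventually_sign_volumeForm_eq o (x := x)
    (X := ![S.T, normal S.T, fun y => S.phi y (normal S.T y)]) (by
      intro i
      fin_cases i
      exacts [(S.c2At_T x).diffAt, hN, S.diffAt_phi hN]) (by
      rw [hvec]
      change frameSign o S x ≠ 0
      rcases hS.frameSign_eq o hx with h | h <;> rw [h] <;> norm_num)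
  filter_upwards [h, hS.eventually_nabla_ne_zero hx] with y h1 h2
  rw [hvec, hvec] at h1
  change SignType.sign (frameSign o S y) = SignType.sign (frameSign o S x) at h1
  rcases hS.frameSign_eq o hx with h3 | h3 <;> rcases hS.frameSign_eq o h2 with h4 | h4 <;>
    rw [h3, h4] at h1 ⊢ <;> simp at h1

theorem eventually_binormal_eq (hS : S.IsCompatible) (o : ManifoldOrientation M) {x : M}
    (hx : nabla S.T S.T x ≠ 0) :
    ∀ᶠ y in 𝓝 x, binormal o S.T y = frameSign o S x • S.phi y (normal S.T y) := by
  filter_upwards [hS.eventually_frameSign_eq o hx, hS.eventually_nabla_ne_zero hx] with y h1 h2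
  rw [hS.binormal_eq o h2, h1]

theorem diffAt_binormal (hS : S.IsCompatible) (o : ManifoldOrientation M) {x : M}
    (hx : nabla S.T S.T x ≠ 0) : (binormal o S.T).DiffAt x :=
  ((S.diffAt_phi (diffAt_normal hS hx)).smul
    (mdifferentiableAt_const (c := frameSign o S x))).congr (hS.eventually_binormal_eq o hx)

theorem etaStar_apply (hS : S.IsCompatible) (x : M) (v : TangentSpace (𝓡 3) x) :
    S.etaStar x v = inner ℝ (nabla S.T S.T x) (S.phi x v) := eta_apply hS x _

theorem etaStar_T (hS : S.IsCompatible) (x : M) : S.etaStar x (S.T x) = 0 := by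
  rw [hS.etaStar_apply, S.phi_T, inner_zero_right]

theorem etaStar_normal (hS : S.IsCompatible) (x : M) : S.etaStar x (normal S.T x) = 0 := by
  rw [hS.etaStar_apply, normal, map_smul, inner_smul_right, hS.inner_self_phi, mul_zero]

/-- `η* = ∓ k B♭`, the sign being the one of the frame `(T, N, φN)`. -/
theorem etaStar_apply_eq_inner_binormal (hS : S.IsCompatible) (o : ManifoldOrientation M) {x : M}
    (hx : nabla S.T S.T x ≠ 0) (v : TangentSpace (𝓡 3) x) :
    S.etaStar x v = -(frameSign o S x * curv S.T x) * inner ℝ (binormal o S.T x) v := by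
  rw [hS.etaStar_apply, hS.binormal_eq o hx, inner_smul_left, hS.inner_phi,
    ← curv_smul_normal hx, inner_smul_left]
  rcases hS.frameSign_eq o hx with h | h <;> simp [h]

/-- `τ + h_{N,B} = ⟨∇_N B, T⟩ - ⟨∇_T B, N⟩ = ⟨B, [T, N]⟩`. -/
theorem tors_add_secondFF (hS : S.IsCompatible) (o : ManifoldOrientation M) {x : M}
    (hx : nabla S.T S.T x ≠ 0) :
    tors o S.T x + secondFF S.T (normal S.T) (binormal o S.T) x =
      inner ℝ (binormal o S.T x) (VectorField.mlieBracket (𝓡 3) S.T (normal S.T) x) := by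
  have hT := (S.c2At_T x).diffAt
  have hN := diffAt_normal hS hx
  have hB := hS.diffAt_binormal o hx
  rw [tors, secondFF, metric_nabla hT hB hN, metric_nabla hN hB hT, neg_add_eq_sub,
    koszul_sub_koszul, metric, real_inner_comm]
  · refine .of_forall fun y => ?_
    rw [metric, hS.inner_T, hS.omega_normal]
  · filter_upwards [hS.eventually_binormal_eq o hx] with y hy
    rw [metric, hy, inner_smul_right, hS.inner_self_phi, mul_zero]
  · filter_upwards [hS.eventually_binormal_eq o hx] with y hy
    rw [metric, hy, inner_smul_right, hS.inner_T_phi, mul_zero]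

/-- The value of `η* ∧ dη*` on the Frenet frame of the `T`-curves. As `η*` vanishes on `T` and `N`,
it is `η*(B) dη*(T, N) = -η*(B) η*([T, N])`, and the sign of the frame enters twice. -/
theorem gvForm_frenet (hS : S.IsCompatible) (o : ManifoldOrientation M) {x : M}
    (hx : nabla S.T S.T x ≠ 0) :
    S.gvForm x ![S.T x, normal S.T x, binormal o S.T x] =
      -(curv S.T x ^ 2 * (tors o S.T x + secondFF S.T (normal S.T) (binormal o S.T) x)) := by
  have h1 : S.gvForm x ![S.T x, normal S.T x, binormal o S.T x] =
      S.etaStar x (S.T x) * dOne S.etaStar x ![normal S.T x, binormal o S.T x]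
      - S.etaStar x (normal S.T x) * dOne S.etaStar x ![S.T x, binormal o S.T x]
      + S.etaStar x (binormal o S.T x) * dOne S.etaStar x ![S.T x, normal S.T x] := rfl
  rw [h1, hS.etaStar_T, hS.etaStar_normal,
    dOne_apply (diffAt_etaStar hS x) (S.c2At_T x).diffAt (diffAt_normal hS hx),
    deriveAlong_eq_zero _ (f := fun y => S.etaStar y (normal S.T y))
      (.of_forall hS.etaStar_normal),
    deriveAlong_eq_zero _ (f := fun y => S.etaStar y (S.T y)) (.of_forall hS.etaStar_T),
    hS.etaStar_apply_eq_inner_binormal o hx, hS.etaStar_apply_eq_inner_binormal o hx,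
    hS.tors_add_secondFF o hx, hS.inner_binormal_self o hx]
  rcases hS.frameSign_eq o hx with h | h <;> rw [h] <;> ring

/-- The pointwise identity `η* ∧ dη* = -k² (τ + h_{N,B}) dvol`, also valid where `k = 0`. -/
theorem gvForm_apply (hS : S.IsCompatible) (o : ManifoldOrientation M) (x : M)
    (v : Fin 3 → TangentSpace (𝓡 3) x) :
    S.gvForm x v =
      -(curv S.T x ^ 2 * (tors o S.T x + secondFF S.T (normal S.T) (binormal o S.T) x)) *
        (o.at' x).volumeForm v := by
  by_cases hx : nabla S.T S.T x = 0
  -- Where `∇_T T` vanishes, so does `η*`, and both sides are zero.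
  · have h0 (w : TangentSpace (𝓡 3) x) : S.etaStar x w = 0 := by
      rw [hS.etaStar_apply, hx, inner_zero_left]
    have h1 : S.gvForm x v = S.etaStar x (v 0) * dOne S.etaStar x ![v 1, v 2]
      - S.etaStar x (v 1) * dOne S.etaStar x ![v 0, v 2]
      + S.etaStar x (v 2) * dOne S.etaStar x ![v 0, v 1] := rfl
    rw [h1, h0, h0, h0, curv, hx, norm_zero]
    ring
  · rw [alternatingMap_apply_eq_mul_volumeForm (o.at' x) (S.gvForm x)
      (e := ![S.T x, normal S.T x, binormal o S.T x]), hS.gvForm_frenet o hx]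
    rw [← inner_cross o S.T (normal S.T)]
    exact hS.inner_binormal_self o hx

end AlmostContactStructure.IsCompatible

end Binormal

/-! ### Densities and integration -/

section Measurability

variable {M : Type*} [TopologicalSpace M] [ChartedSpace E3 M]
  [SecondCountableTopology M] [MeasurableSpace M] [BorelSpace M]

variable (M) in
theorem countable_range_chartSelector : (range (chartSelector (M := M))).Countable :=
  (exists_chartSelector M).choose_spec.1

theorem measurableSet_chartSelector_preimage (p : M) :
    MeasurableSet (chartSelector (M := M) ⁻¹' {p}) :=
  (exists_chartSelector M).choose_spec.2.1 p

theorem mem_source_chartSelector (x : M) : x ∈ (extChartAt (𝓡 3) (chartSelector x)).source :=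
  (exists_chartSelector M).choose_spec.2.2 x

/-- A function glued from functions continuous on the domains of the selected charts is
measurable. -/
theorem measurable_of_continuousOn_chart {F : M → M → ℝ}
    (hF : ∀ p, ContinuousOn (F p) (extChartAt (𝓡 3) p).source) :
    Measurable fun x => F (chartSelector x) x := by
  intro s hs
  have h : (fun x => F (chartSelector x) x) ⁻¹' s =
      ⋃ p ∈ range (chartSelector (M := M)), chartSelector ⁻¹' {p} ∩
        ((extChartAt (𝓡 3) p).source ∩ F p ⁻¹' s) := by
    ext x
    simp only [mem_preimage, mem_range, iUnion_exists, iUnion_iUnion_eq', mem_iUnion, mem_inter_iff,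
      mem_singleton_iff]
    constructor
    · intro hx
      exact ⟨x, rfl, mem_source_chartSelector x, hx⟩
    · rintro ⟨y, h1, -, h3⟩
      rwa [h1]
  rw [h]
  refine MeasurableSet.biUnion (countable_range_chartSelector M) fun p _ =>
    (measurableSet_chartSelector_preimage p).inter ?_
  have ho : MeasurableSet (extChartAt (𝓡 3) p).source := (isOpen_extChartAt_source p).measurableSet
  have hm : Measurable ((extChartAt (𝓡 3) p).source.domRestrict (F p)) :=
    (continuousOn_iff_continuous_domRestrict.1 (hF p)).measurable
  have h2 : MeasurableSet (Subtype.val ''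
      (Subtype.val ⁻¹' (F p ⁻¹' s) : Set (extChartAt (𝓡 3) p).source)) :=
    ho.subtype_image (hm hs)
  rwa [Subtype.image_preimage_coe] at h2

variable [IsManifold (𝓡 3) ∞ M] [RiemannianBundle (fun x : M => TangentSpace (𝓡 3) x)]
  [IsContMDiffRiemannianBundle (𝓡 3) ∞ E3 (fun x : M => TangentSpace (𝓡 3) x)]

omit [SecondCountableTopology M] [MeasurableSpace M] [BorelSpace M] in
theorem continuousOn_sqrt_det_gram (p : M) :
    ContinuousOn (fun x => Real.sqrt (Matrix.det (Matrix.of fun i j : Fin 3 =>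
      (inner ℝ (coordFrame p x i) (coordFrame p x j) : ℝ)))) (extChartAt (𝓡 3) p).source := by
  intro x hx
  have h1 : ContinuousAt (fun y => (Matrix.of fun i j : Fin 3 =>
      (inner ℝ (coordFrame p y i) (coordFrame p y j) : ℝ) : Matrix (Fin 3) (Fin 3) ℝ)) x :=
    continuousAt_pi.2 fun i => continuousAt_pi.2 fun j =>
      (mdifferentiableAt_metric (VField.diffAt_coordFrame hx i)
        (VField.diffAt_coordFrame hx j)).continuousAt
  exact ((Real.continuous_sqrt.comp continuous_id.matrix_det).continuousAt.comp
    h1).continuousWithinAt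

/-- The density of `η* ∧ dη*` is the one of `-k² (τ + h_{N,B}) dvol`. -/
theorem AlmostContactStructure.IsCompatible.formDensity_gvForm {S : AlmostContactStructure M}
    (hS : S.IsCompatible) (o : ManifoldOrientation M) (x : M) :
    formDensity o S.gvForm x = Real.sqrt (Matrix.det (Matrix.of fun i j : Fin 3 =>
      (inner ℝ (coordFrame (chartSelector x) x i) (coordFrame (chartSelector x) x j) : ℝ))) *
      -(curv S.T x ^ 2 * (tors o S.T x + secondFF S.T (normal S.T) (binormal o S.T) x)) := by
  rw [det_gram_eq_volumeForm_sq (o.at' x), Real.sqrt_sq_eq_abs, formDensity, hS.gvForm_apply o,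
    orientationSign_eq, ← sign_mul_self ((o.at' x).volumeForm _)]
  ring

end Measurability

end GodbillonVey

end

open GodbillonVey
theorem mainTheorem3 {M : Type*} [TopologicalSpace M] [ChartedSpace E3 M]
    [IsManifold (𝓡 3) ∞ M] [T2Space M] [SecondCountableTopology M]
    [MeasurableSpace M] [BorelSpace M]
    [RiemannianBundle (fun x : M => TangentSpace (𝓡 3) x)]
    [IsContMDiffRiemannianBundle (𝓡 3) ∞ E3 (fun x : M => TangentSpace (𝓡 3) x)]
    (o : ManifoldOrientation M) (S : AlmostContactStructure M) (hS : S.IsCompatible) :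
    (FormIntegrable o S.gvForm ↔
      Integrable (fun x => curv S.T x ^ 2 *
        (tors o S.T x + secondFF S.T (normal S.T) (binormal o S.T) x)) (riemannianVolume M)) ∧
    gvStar o S = -∫ x, curv S.T x ^ 2 *
        (tors o S.T x + secondFF S.T (normal S.T) (binormal o S.T) x) ∂(riemannianVolume M) := by
  have hm := (measurable_of_continuousOn_chart (M := M) continuousOn_sqrt_det_gram).ennreal_ofReal
  have hlt : ∀ᵐ x ∂(coordMeasure M), ENNReal.ofReal (Real.sqrt (Matrix.det (Matrix.of
      fun i j : Fin 3 => (inner ℝ (coordFrame (chartSelector x) x i)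
        (coordFrame (chartSelector x) x j) : ℝ)))) < ⊤ := .of_forall fun x => ENNReal.ofReal_lt_top
  constructor
  · rw [FormIntegrable, ← integrable_neg_iff (μ := riemannianVolume M), riemannianVolume,
      integrable_withDensity_iff_integrable_smul' hm hlt]
    refine integrable_congr (.of_forall fun x => ?_)
    simp only [hS.formDensity_gvForm, ENNReal.toReal_ofReal (Real.sqrt_nonneg _), smul_eq_mul,
      Pi.neg_apply]
  · rw [gvStar, formIntegral, ← integral_neg, riemannianVolume,
      integral_withDensity_eq_integral_toReal_smul hm hlt]
    refine integral_congr_ae (.of_forall fun x => ?_)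
    simp only [hS.formDensity_gvForm, ENNReal.toReal_ofReal (Real.sqrt_nonneg _), smul_eq_mul]
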